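/- A partition $\lambda$ is identified with its Young diagram; the hook of a box of $\lambda$ consists of that box, the boxes to its right in the same row and the boxes below it in the same column, and the hook length of the box is the number of boxes in its hook. For a positive integer $r$ let $H_r(\lambda)$ be the product of the numbers $h/r$, where $h$ runs (with multiplicity) through the hook lengths of $\lambda$ that are divisible by $r$ (an empty product being $1$). For positive integers $\gamma_1,\dots,\gamma_K$ and $\delta_1,\dots,\delta_L$ put $$v(\lambda;\vec\gamma,\vec\delta)=\frac{\prod_{k=1}^K H_{\gamma_k}(\lambda)}{\prod_{l=1}^L H_{\delta_l}(\lambda)}.$$ Theorem 3. Let $\vec\gamma=(\gamma_1,\dots,\gamma_K)$ and $\vec\delta=(\delta_1,\dots,\delta_L)$ be vectors of positive integers with $\gamma_k\neq\delta_l$ for all $k$ and $l$. Suppose that $v(\lambda;\vec\gamma,\vec\delta)$ is an integer for all partitions $\lambda$, that $\sum_{k=1}^K \frac1{\gamma_k}=\sum_{l=1}^L\frac1{\delta_l}$, and that $L-K=1$. Then $K=1$, $L=2$ and $\delta_1=\delta_2=2\gamma_1$. -/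

import Mathlib

namespace HookRatio

/-- The hook of the Young diagram `μ` based at the box `c`: the box `c` itself together with the
boxes of `μ` in the same row strictly to its right and in the same column strictly below it
(boxes are pairs `(row, column)`). -/
def hook (μ : YoungDiagram) (c : ℕ × ℕ) : Finset (ℕ × ℕ) :=
  μ.cells.filter fun b =>
    b = c ∨ (b.1 = c.1 ∧ c.2 < b.2) ∨ (b.2 = c.2 ∧ c.1 < b.1)

/-- The hook length of the box `c` of `μ`. -/
def hookLength (μ : YoungDiagram) (c : ℕ × ℕ) : ℕ :=
  (hook μ c).card

/-- The multiset of the hook lengths of all the boxes of `μ`. -/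
def hookLengths (μ : YoungDiagram) : Multiset ℕ :=
  μ.cells.val.map (hookLength μ)

/-- The multiset of the `h / r`, for `h` running through the hook lengths of `μ` that are
divisible by `r` (with repetitions). -/
def quotientHookLengths (r : ℕ) (μ : YoungDiagram) : Multiset ℕ :=
  ((hookLengths μ).filter fun h => r ∣ h).map fun h => h / r

/-- The product of the `h / r`, for `h` running through the hook lengths of `μ` that are
divisible by `r`. -/
def hookProduct (r : ℕ) (μ : YoungDiagram) : ℕ :=
  (quotientHookLengths r μ).prod

/-- The hook ratio `v(μ; γ, δ)`, a rational number. -/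
def hookRatio {K L : ℕ} (γ : Fin K → ℕ) (δ : Fin L → ℕ) (μ : YoungDiagram) : ℚ :=
  (∏ k, (hookProduct (γ k) μ : ℚ)) / ∏ l, (hookProduct (δ l) μ : ℚ)

end HookRatio

/-!
Only the hook-shaped partitions `(a + 1, 1, …, 1)` are needed. Put
`F n = ∑ ⌊n / γ_k⌋ - ∑ ⌊n / δ_l⌋` for `n : ℤ` (`stepFun`). Because of the balance condition `F` is
periodic, and because `L - K = 1` it satisfies `F (-1 - n) = 1 - F n`. The hook lengths of the hook
with arm `a` and leg `b` are `1, …, a`, `1, …, b` and `a + b + 1`, so the exponent in `v` of a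
prime `p` with `a + b + 1 < p ^ 2` is explicit
(`factorization_hookProduct_hookDiagram`). Letting `a` and `b` be about `m * p` and `n * p`,
integrality gives `F n ≥ 0` and `F m + F n + (F z - F (z - 1)) ≥ 0` with `z = m + n + 1`
(`stepFun_natCast_nonneg`, `stepFun_hook_natCast`), first for natural numbers and then, by
periodicity, for all integers.

Hence `F` takes the values `0` and `1` only. If `z` is a descent, meaning `F z = 0` and
`F (z - 1) = 1`, the last inequality reads `F m ≥ F (m - z)` for all `m`, and periodicity turns it
into an equality: every descent is a period. So with `g` the least positive descent, `F` is
`0` and then `1` on a period of length `g`, and the reflection makes the two halves equally long,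
`g = 2 * c` (`exists_square_wave`). Therefore `F z = ⌊z / c⌋ - 2 * ⌊z / (2 * c)⌋`, and since the
indicator functions of `r ∣ z` are linearly independent (`eq_of_sum_divisors_eq`), the disjointness
of the two vectors forces all `γ_k = c` and all `δ_l = 2 * c`.
-/

namespace HookRatio

/-! ### Valuations of hook products -/

lemma hookLength_pos {μ : YoungDiagram} {c : ℕ × ℕ} (hc : c ∈ μ.cells) : 0 < hookLength μ c :=
  Finset.card_pos.mpr ⟨c, by simpa [hook] using hc⟩

lemma hookProduct_eq_prod (r : ℕ) (μ : YoungDiagram) :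
    hookProduct r μ = ∏ c ∈ μ.cells with r ∣ hookLength μ c, hookLength μ c / r := by
  simp [hookProduct, quotientHookLengths, hookLengths, Multiset.filter_map, Finset.prod]

lemma hookProduct_ne_zero {r : ℕ} (hr : 0 < r) (μ : YoungDiagram) : hookProduct r μ ≠ 0 := by
  rw [hookProduct_eq_prod, Finset.prod_ne_zero_iff]
  intro c hc
  rw [Finset.mem_filter] at hc
  exact (Nat.div_pos (Nat.le_of_dvd (hookLength_pos hc.1) hc.2) hr).ne'

/-- If all hook lengths are below `p ^ 2`, each factor of `H_r` contributes at most one power of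
`p`, and the factor `h / r` does so exactly when `r * p ∣ h`. -/
lemma factorization_hookProduct {r p : ℕ} (hr : 0 < r) (hp : p.Prime) (μ : YoungDiagram)
    (hμ : ∀ c ∈ μ.cells, hookLength μ c < p ^ 2) :
    (hookProduct r μ).factorization p =
      ∑ c ∈ μ.cells, if r * p ∣ hookLength μ c then 1 else 0 := by
  have hpos : ∀ c ∈ μ.cells.filter (fun c => r ∣ hookLength μ c), hookLength μ c / r ≠ 0 := by
    intro c hc
    rw [Finset.mem_filter] at hc
    exact (Nat.div_pos (Nat.le_of_dvd (hookLength_pos hc.1) hc.2) hr).ne'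
  rw [hookProduct_eq_prod, Nat.factorization_prod_apply hpos, Finset.sum_filter]
  refine Finset.sum_congr rfl fun c hc => ?_
  have hlt := hμ c hc
  have h0 := hookLength_pos hc
  by_cases hrc : r ∣ hookLength μ c
  · obtain ⟨q, hq⟩ := hrc
    have hq0 : q ≠ 0 := by rintro rfl; omega
    rw [hq, if_pos (dvd_mul_right r q), Nat.mul_div_cancel_left q hr]
    simp only [Nat.mul_dvd_mul_iff_left hr]
    split_ifs with h
    · apply le_antisymm
      · by_contra! h2
        have := Nat.le_of_dvd (Nat.pos_of_ne_zero hq0)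
          ((hp.pow_dvd_iff_le_factorization hq0).mpr h2)
        nlinarith
      · exact (hp.dvd_iff_one_le_factorization hq0).mp h
    · exact Nat.factorization_eq_zero_of_not_dvd h
  · rw [if_neg hrc, if_neg fun h => hrc (dvd_of_mul_right_dvd h)]

/-! ### Hook-shaped diagrams -/

/-- The Young diagram of the partition `(a + 1, 1, …, 1)` with `b` ones: a corner box with an arm
of `a` boxes and a leg of `b` boxes. -/
def hookDiagram (a b : ℕ) : YoungDiagram where
  cells := (Finset.range (b + 1) ×ˢ Finset.range (a + 1)).filter fun c => c.1 = 0 ∨ c.2 = 0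
  isLowerSet := by
    rintro ⟨i, j⟩ ⟨i', j'⟩ ⟨h1, h2⟩ h
    simp only [Finset.coe_filter, Finset.mem_product, Finset.mem_range,
      Set.mem_ofPred_eq] at h h1 h2 ⊢
    omega

lemma mem_cells_hookDiagram {a b : ℕ} {c : ℕ × ℕ} :
    c ∈ (hookDiagram a b).cells ↔ c.1 ≤ b ∧ c.2 ≤ a ∧ (c.1 = 0 ∨ c.2 = 0) := by
  simp only [hookDiagram, Finset.mem_filter, Finset.mem_product, Finset.mem_range]
  omega

lemma sum_cells_hookDiagram (a b : ℕ) (φ : ℕ × ℕ → ℕ) :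
    ∑ c ∈ (hookDiagram a b).cells, φ c =
      φ (0, 0) + ∑ j ∈ Finset.range a, φ (0, j + 1) + ∑ i ∈ Finset.range b, φ (i + 1, 0) := by
  have h : (hookDiagram a b).cells =
      insert (0, 0) ((Finset.range a).image (fun j => (0, j + 1)) ∪
        (Finset.range b).image (fun i => (i + 1, 0))) := by
    ext ⟨i, j⟩
    simp only [mem_cells_hookDiagram, Finset.mem_insert, Finset.mem_union, Finset.mem_image,
      Finset.mem_range, Prod.mk.injEq]
    constructor
    · rintro ⟨h1, h2, rfl | rfl⟩
      · rcases j with _ | j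
        · simp
        · exact Or.inr (Or.inl ⟨j, by omega, rfl, rfl⟩)
      · rcases i with _ | i
        · simp
        · exact Or.inr (Or.inr ⟨i, by omega, rfl, rfl⟩)
    · rintro (⟨rfl, rfl⟩ | ⟨x, hx, rfl, rfl⟩ | ⟨x, hx, rfl, rfl⟩) <;> omega
  rw [h, Finset.sum_insert (by simp), Finset.sum_union, Finset.sum_image, Finset.sum_image, add_assoc]
  · intro x _ y _ hxy; simpa using hxy
  · intro x _ y _ hxy; simpa using hxy
  · rw [Finset.disjoint_left]
    intro c hc hc'
    simp only [Finset.mem_image] at hc hc'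
    obtain ⟨x, -, rfl⟩ := hc
    obtain ⟨y, -, hy⟩ := hc'
    simp at hy

lemma hookLength_hookDiagram_corner (a b : ℕ) :
    hookLength (hookDiagram a b) (0, 0) = a + b + 1 := by
  have h : hook (hookDiagram a b) (0, 0) = (hookDiagram a b).cells := by
    refine Finset.filter_true_of_mem ?_
    rintro ⟨i, j⟩ hc
    simp only [mem_cells_hookDiagram, Prod.mk.injEq] at hc ⊢
    omega
  rw [hookLength, h, Finset.card_eq_sum_ones, sum_cells_hookDiagram]
  simp
  omega

lemma hookLength_hookDiagram_arm {a j : ℕ} (b : ℕ) (_ : j < a) :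
    hookLength (hookDiagram a b) (0, j + 1) = a - j := by
  have h : hook (hookDiagram a b) (0, j + 1) = (Finset.Ioc j a).image fun x => (0, x) := by
    ext ⟨x, y⟩
    simp only [hook, Finset.mem_filter, mem_cells_hookDiagram, Prod.mk.injEq, Finset.mem_image,
      Finset.mem_Ioc]
    constructor
    · intro h
      exact ⟨y, by omega, by omega, rfl⟩
    · rintro ⟨z, hz, rfl, rfl⟩
      omega
  rw [hookLength, h, Finset.card_image_of_injective _ (Prod.mk_right_injective 0), Nat.card_Ioc]

lemma hookLength_hookDiagram_leg {b i : ℕ} (a : ℕ) (_ : i < b) :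
    hookLength (hookDiagram a b) (i + 1, 0) = b - i := by
  have h : hook (hookDiagram a b) (i + 1, 0) = (Finset.Ioc i b).image fun x => (x, 0) := by
    ext ⟨x, y⟩
    simp only [hook, Finset.mem_filter, mem_cells_hookDiagram, Prod.mk.injEq, Finset.mem_image,
      Finset.mem_Ioc]
    constructor
    · intro h
      exact ⟨x, by omega, rfl, by omega⟩
    · rintro ⟨z, hz, rfl, rfl⟩
      omega
  rw [hookLength, h, Finset.card_image_of_injective _ (Prod.mk_left_injective 0), Nat.card_Ioc]

/-- The hook lengths of a hook-shaped diagram are `a + b + 1`, `1, …, a` and `1, …, b`. -/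
lemma sum_hookLength_hookDiagram (a b : ℕ) (φ : ℕ → ℕ) :
    ∑ c ∈ (hookDiagram a b).cells, φ (hookLength (hookDiagram a b) c) =
      φ (a + b + 1) + ∑ j ∈ Finset.range a, φ (j + 1) + ∑ i ∈ Finset.range b, φ (i + 1) := by
  rw [sum_cells_hookDiagram a b (fun c => φ (hookLength (hookDiagram a b) c)),
    hookLength_hookDiagram_corner]
  congr 1
  · congr 1
    rw [← Finset.sum_range_reflect (fun j => φ (j + 1))]
    refine Finset.sum_congr rfl fun j hj => ?_
    rw [Finset.mem_range] at hj
    rw [hookLength_hookDiagram_arm b hj]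
    congr 1
    omega
  · rw [← Finset.sum_range_reflect (fun j => φ (j + 1))]
    refine Finset.sum_congr rfl fun j hj => ?_
    rw [Finset.mem_range] at hj
    rw [hookLength_hookDiagram_leg a hj]
    congr 1
    omega

lemma sum_range_ite_dvd (n d : ℕ) :
    (∑ i ∈ Finset.range n, if d ∣ i + 1 then 1 else 0) = n / d := by
  rw [← Finset.card_filter, Nat.card_multiples]

lemma factorization_hookProduct_hookDiagram {r p a b : ℕ} (hr : 0 < r) (hp : p.Prime)
    (hab : a + b + 1 < p ^ 2) :
    (hookProduct r (hookDiagram a b)).factorization p =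
      (if r * p ∣ a + b + 1 then 1 else 0) + a / (r * p) + b / (r * p) := by
  rw [factorization_hookProduct hr hp,
    sum_hookLength_hookDiagram a b (fun h => if r * p ∣ h then 1 else 0),
    sum_range_ite_dvd, sum_range_ite_dvd]
  rintro ⟨i, j⟩ hc
  rw [mem_cells_hookDiagram] at hc
  obtain ⟨h1, h2, h3⟩ := hc
  dsimp only at h1 h2 h3
  rcases i with _ | i
  · rcases j with _ | j
    · rwa [hookLength_hookDiagram_corner]
    · rw [hookLength_hookDiagram_arm b (by omega)]
      omega
  · obtain rfl : j = 0 := by omega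
    rw [hookLength_hookDiagram_leg a (by omega)]
    omega

/-! ### The step function of a hook ratio -/

section StepFunction

variable {K L : ℕ} (γ : Fin K → ℕ) (δ : Fin L → ℕ)

/-- The step function `n ↦ ∑ ⌊n / γ_k⌋ - ∑ ⌊n / δ_l⌋` on the integers (`/` on `ℤ` is the floor
of the quotient when the divisor is positive). -/
def stepFun (n : ℤ) : ℤ := ∑ k, n / (γ k : ℤ) - ∑ l, n / (δ l : ℤ)

lemma stepFun_zero : stepFun γ δ 0 = 0 := by simp [stepFun]

variable {γ δ}

lemma ediv_sub_ediv_sub_one {d : ℕ} (hd : 0 < d) (z : ℤ) :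
    z / (d : ℤ) - (z - 1) / (d : ℤ) = if (d : ℤ) ∣ z then 1 else 0 := by
  have hd' : (0 : ℤ) < d := by exact_mod_cast hd
  have h1 := Int.mul_ediv_add_emod z d
  have h2 := Int.emod_nonneg z hd'.ne'
  have h3 := Int.emod_lt_of_pos z hd'
  split_ifs with h
  · have h4 := Int.emod_eq_zero_of_dvd h
    have : (z - 1) / (d : ℤ) = z / d - 1 := by
      rw [Int.ediv_eq_iff_of_pos hd']
      constructor <;> nlinarith
    omega
  · have h4 : z % d ≠ 0 := fun h' => h (Int.dvd_of_emod_eq_zero h')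
    have h5 : 1 ≤ z % d := by omega
    have : (z - 1) / (d : ℤ) = z / d := by
      rw [Int.ediv_eq_iff_of_pos hd']
      constructor <;> nlinarith
    omega

lemma stepFun_sub_stepFun_sub_one (hγ : ∀ k, 0 < γ k) (hδ : ∀ l, 0 < δ l) (z : ℤ) :
    stepFun γ δ z - stepFun γ δ (z - 1) =
      (∑ k, if (γ k : ℤ) ∣ z then 1 else 0) - ∑ l, if (δ l : ℤ) ∣ z then 1 else 0 := by
  simp only [← ediv_sub_ediv_sub_one (hγ _), ← ediv_sub_ediv_sub_one (hδ _),
    Finset.sum_sub_distrib, stepFun]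
  ring

lemma stepFun_neg_one_sub (hγ : ∀ k, 0 < γ k) (hδ : ∀ l, 0 < δ l) (n : ℤ) :
    stepFun γ δ (-1 - n) = (L : ℤ) - K - stepFun γ δ n := by
  have key : ∀ d : ℕ, 0 < d → (-1 - n) / (d : ℤ) = -1 - n / d := by
    intro d hd
    have hd' : (0 : ℤ) < d := by exact_mod_cast hd
    have h1 := Int.mul_ediv_add_emod n d
    have h2 := Int.emod_nonneg n hd'.ne'
    have h3 := Int.emod_lt_of_pos n hd'
    rw [Int.ediv_eq_iff_of_pos hd']
    constructor <;> nlinarith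
  simp only [stepFun, key _ (hγ _), key _ (hδ _), Finset.sum_sub_distrib]
  simp
  ring

/-- Balance makes the linear parts of the two floor sums cancel, so the step function is
periodic. -/
lemma exists_period_stepFun (hγ : ∀ k, 0 < γ k) (hδ : ∀ l, 0 < δ l)
    (hbal : ∑ k, (1 : ℚ) / (γ k : ℚ) = ∑ l, (1 : ℚ) / (δ l : ℚ)) :
    ∃ N : ℕ, 0 < N ∧ Function.Periodic (stepFun γ δ) (N : ℤ) := by
  set N : ℕ := (∏ k, γ k) * ∏ l, δ l with hN
  have hNγ : ∀ k, γ k ∣ N := fun k =>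
    (Finset.dvd_prod_of_mem γ (Finset.mem_univ k)).mul_right _
  have hNδ : ∀ l, δ l ∣ N := fun l =>
    (Finset.dvd_prod_of_mem δ (Finset.mem_univ l)).mul_left _
  refine ⟨N, Nat.mul_pos (Finset.prod_pos fun k _ => hγ k) (Finset.prod_pos fun l _ => hδ l),
    fun n => ?_⟩
  have hsum : ∑ k, (N : ℤ) / (γ k : ℤ) = ∑ l, (N : ℤ) / (δ l : ℤ) := by
    have h := congrArg (fun x : ℚ => (N : ℚ) * x) hbal
    simp only [Finset.mul_sum] at h
    have e1 : ∀ d : ℕ, d ∣ N → 0 < d → (((N : ℤ) / (d : ℤ) : ℤ) : ℚ) = (N : ℚ) * (1 / d) := by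
      intro d hd hd0
      rw [Int.cast_div (by exact_mod_cast hd) (by exact_mod_cast hd0.ne')]
      push_cast
      ring
    have : ((∑ k, (N : ℤ) / (γ k : ℤ) : ℤ) : ℚ) = ((∑ l, (N : ℤ) / (δ l : ℤ) : ℤ) : ℚ) := by
      rw [Int.cast_sum, Int.cast_sum]
      simp only [e1 _ (hNγ _) (hγ _), e1 _ (hNδ _) (hδ _)]
      exact h
    exact_mod_cast this
  have e2 : ∀ d : ℕ, d ∣ N → (n + (N : ℤ)) / (d : ℤ) = n / d + N / d := fun d hd =>
    Int.add_ediv_of_dvd_right (by exact_mod_cast hd)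
  simp only [stepFun, e2 _ (hNγ _), e2 _ (hNδ _), Finset.sum_add_distrib, hsum]
  ring

/-! ### Inequalities from integrality -/

lemma prod_hookProduct_dvd (hδ : ∀ l, 0 < δ l) {μ : YoungDiagram}
    (h : ∃ z : ℤ, hookRatio γ δ μ = z) :
    ∏ l, hookProduct (δ l) μ ∣ ∏ k, hookProduct (γ k) μ := by
  obtain ⟨z, hz⟩ := h
  have h0 : (∏ l, (hookProduct (δ l) μ : ℚ)) ≠ 0 :=
    Finset.prod_ne_zero_iff.mpr fun l _ => by exact_mod_cast hookProduct_ne_zero (hδ l) μ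
  rw [hookRatio, div_eq_iff h0] at hz
  have : ((∏ l, hookProduct (δ l) μ : ℕ) : ℤ) ∣ ((∏ k, hookProduct (γ k) μ : ℕ) : ℤ) :=
    ⟨z, by rw [mul_comm]; exact_mod_cast hz⟩
  exact_mod_cast this

lemma sum_factorization_le (hγ : ∀ k, 0 < γ k) (hδ : ∀ l, 0 < δ l)
    {μ : YoungDiagram} (h : ∃ z : ℤ, hookRatio γ δ μ = z) (p : ℕ) :
    ∑ l, (hookProduct (δ l) μ).factorization p ≤ ∑ k, (hookProduct (γ k) μ).factorization p := by
  have h1 := prod_hookProduct_dvd hδ h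
  rw [← Nat.factorization_le_iff_dvd
    (Finset.prod_ne_zero_iff.mpr fun l _ => hookProduct_ne_zero (hδ l) μ)
    (Finset.prod_ne_zero_iff.mpr fun k _ => hookProduct_ne_zero (hγ k) μ)] at h1
  have h2 := h1 p
  rwa [Nat.factorization_prod_apply fun l _ => hookProduct_ne_zero (hδ l) μ,
    Nat.factorization_prod_apply fun k _ => hookProduct_ne_zero (hγ k) μ] at h2

/-- The step function at `n` is the exponent of a large prime `p` in the hook ratio of the hook with
arm `n * p` and no leg: its largest hook length `n * p + 1` is prime to `p`. -/
lemma stepFun_natCast_nonneg (hγ : ∀ k, 0 < γ k) (hδ : ∀ l, 0 < δ l)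
    (hint : ∀ μ : YoungDiagram, ∃ z : ℤ, hookRatio γ δ μ = z) (n : ℕ) :
    0 ≤ stepFun γ δ n := by
  obtain ⟨p, hpn, hp⟩ := Nat.exists_infinite_primes (n + 2)
  have h := sum_factorization_le hγ hδ (hint (hookDiagram (n * p) 0)) p
  have key : ∀ r, 0 < r → (hookProduct r (hookDiagram (n * p) 0)).factorization p = n / r := by
    intro r hr
    rw [factorization_hookProduct_hookDiagram hr hp (by nlinarith), if_neg,
      Nat.mul_div_mul_right _ _ hp.pos]
    · simp
    · intro hd
      have h1 : p ∣ n * p + 0 + 1 := (dvd_mul_left p r).trans hd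
      rw [add_zero, Nat.dvd_add_right (dvd_mul_left p n)] at h1
      exact hp.one_lt.ne' (Nat.dvd_one.mp h1)
  simp only [key _ (hγ _), key _ (hδ _)] at h
  rw [stepFun, sub_nonneg]
  exact_mod_cast h

/-- The hook with arm `m * p` and leg `n * p + (p - 1)` has corner hook length `(m + n + 1) * p`, so
for a large prime `p` the exponent of `p` in its hook ratio is `F m + F n + (F z - F (z - 1))`, where
`F` is the step function and `z = m + n + 1`; the difference comes from the corner box. -/
lemma stepFun_hook_natCast (hγ : ∀ k, 0 < γ k) (hδ : ∀ l, 0 < δ l)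
    (hint : ∀ μ : YoungDiagram, ∃ z : ℤ, hookRatio γ δ μ = z) (m n : ℕ) :
    stepFun γ δ (m + n) ≤ stepFun γ δ m + stepFun γ δ n + stepFun γ δ (m + n + 1) := by
  obtain ⟨p, hpn, hp⟩ := Nat.exists_infinite_primes (m + n + 2)
  have hsize : m * p + (n * p + (p - 1)) + 1 = (m + n + 1) * p := by
    have := hp.pos
    have e : (m + n + 1) * p = m * p + n * p + p := by ring
    omega
  have h := sum_factorization_le hγ hδ (hint (hookDiagram (m * p) (n * p + (p - 1)))) p
  have key : ∀ r, 0 < r →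
      (hookProduct r (hookDiagram (m * p) (n * p + (p - 1)))).factorization p =
        (if r ∣ m + n + 1 then 1 else 0) + m / r + n / r := by
    intro r hr
    rw [factorization_hookProduct_hookDiagram hr hp (by rw [hsize]; nlinarith), hsize,
      Nat.mul_div_mul_right _ _ hp.pos]
    congr 1
    · simp only [Nat.mul_dvd_mul_iff_right hp.pos]
    · rw [mul_comm r p, ← Nat.div_div_eq_div_mul]
      congr 1
      rw [Nat.div_eq_iff hp.pos]
      have := hp.pos
      constructor <;> omega
  simp only [key _ (hγ _), key _ (hδ _), Finset.sum_add_distrib] at h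
  have hε := stepFun_sub_stepFun_sub_one hγ hδ ((m + n + 1 : ℕ) : ℤ)
  simp only [Int.natCast_dvd_natCast] at hε
  push_cast at hε
  rw [add_sub_cancel_right] at hε
  have h' : (∑ l, if δ l ∣ m + n + 1 then (1 : ℤ) else 0) + ∑ l, (m : ℤ) / (δ l : ℤ)
      + ∑ l, (n : ℤ) / (δ l : ℤ) ≤ (∑ k, if γ k ∣ m + n + 1 then (1 : ℤ) else 0)
      + ∑ k, (m : ℤ) / (γ k : ℤ) + ∑ k, (n : ℤ) / (γ k : ℤ) := by
    exact_mod_cast h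
  have em : stepFun γ δ m = ∑ k, (m : ℤ) / (γ k : ℤ) - ∑ l, (m : ℤ) / (δ l : ℤ) := rfl
  have en : stepFun γ δ n = ∑ k, (n : ℤ) / (γ k : ℤ) - ∑ l, (n : ℤ) / (δ l : ℤ) := rfl
  linarith

end StepFunction

/-- Every residue class has a nonnegative representative, so that a statement about a periodic
function on `ℤ` only needs to be checked on `ℕ`. -/
lemma exists_natCast_eq_add_mul {N : ℕ} (hN : 0 < N) (m : ℤ) :
    ∃ a : ℕ, ∃ t : ℤ, (a : ℤ) = m + t * N := by
  have hN' : (N : ℤ) ≠ 0 := by exact_mod_cast hN.ne'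
  refine ⟨(m % N).toNat, -(m / N), ?_⟩
  rw [Int.toNat_of_nonneg (Int.emod_nonneg m hN')]
  linarith [Int.mul_ediv_add_emod m N, mul_comm (m / N) (N : ℤ)]

/-! ### Rigidity of the step function -/

/-- The inequality `hhook` at `m + n + 1 = z` says, through the reflection
`F (-1 - n) = 1 - F n`, that every descent `z` of `F` is a period. Descents and ascents of a
function with values `0` and `1` alternate, so one period contains a single ascent, which the
reflection puts in the middle. -/
lemma exists_square_wave {F : ℤ → ℤ} {N : ℕ} (hN : 0 < N) (hper : Function.Periodic F (N : ℤ))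
    (h0 : F 0 = 0) (hnonneg : ∀ n, 0 ≤ F n) (hrefl : ∀ n, F (-1 - n) = 1 - F n)
    (hhook : ∀ m n, F (m + n) ≤ F m + F n + F (m + n + 1)) :
    ∃ c : ℕ, 0 < c ∧ ∀ z, F z = z / (c : ℤ) - 2 * (z / (2 * c : ℤ)) := by
  have hle : ∀ n, F n ≤ 1 := fun n => by linarith [hnonneg (-1 - n), hrefl n]
  have hex : ∃ g : ℕ, 0 < g ∧ F g = 0 ∧ F (g - 1) = 1 := by
    refine ⟨N, hN, ?_, ?_⟩
    · rw [← zero_add (N : ℤ), hper, h0]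
    · rw [show (N : ℤ) - 1 = -1 - 0 + N by ring, hper, hrefl, h0, sub_zero]
  classical
  set g := Nat.find hex with hg
  obtain ⟨hgpos, hg0, hg1⟩ := Nat.find_spec hex
  have hmin : ∀ m < g, ¬ (0 < m ∧ F m = 0 ∧ F (m - 1) = 1) := fun m hm => Nat.find_min hex hm
  rw [← hg] at hgpos hg0 hg1
  have hmono : ∀ m, F (m - g) ≤ F m := by
    intro m
    have h := hhook m (g - 1 - m)
    rw [show m + ((g : ℤ) - 1 - m) = g - 1 by ring, hg1, sub_add_cancel, hg0,
      show (g : ℤ) - 1 - m = -1 - (m - g) by ring, hrefl] at h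
    linarith
  have hiter : ∀ (t : ℕ) (m : ℤ), F (m - t * g) ≤ F m := by
    intro t
    induction t with
    | zero => simp
    | succ t ih =>
      intro m
      have := hmono (m - t * g)
      rw [show m - (t : ℤ) * g - g = m - ((t + 1 : ℕ) : ℤ) * g by push_cast; ring] at this
      exact this.trans (ih m)
  have hgper : Function.Periodic F (g : ℤ) := by
    intro m
    apply le_antisymm
    · -- `F (m + t * g)` is monotone in `t`, and returns to `F m` at `t = N`.
      have h := hiter (N - 1) (m + N * g)
      rw [show m + (N : ℤ) * g - ((N - 1 : ℕ) : ℤ) * g = m + g by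
        rw [Nat.cast_sub hN]; push_cast; ring, mul_comm, ← smul_eq_mul, hper.zsmul] at h
      exact h
    · have := hmono (m + g)
      rwa [add_sub_cancel_right] at this
  have hstep : ∀ i : ℕ, i + 1 < g → F i = 1 → F ((i + 1 : ℕ) : ℤ) = 1 := by
    intro i hi h1
    by_contra h
    have hz : F ((i + 1 : ℕ) : ℤ) = 0 := by
      have := hle ((i + 1 : ℕ) : ℤ); have := hnonneg ((i + 1 : ℕ) : ℤ); omega
    refine hmin (i + 1) hi ⟨by omega, hz, ?_⟩
    rw [show ((i + 1 : ℕ) : ℤ) - 1 = i by push_cast; ring, h1]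
  have hup : ∀ i j : ℕ, i ≤ j → j < g → F i = 1 → F j = 1 := by
    intro i j hij
    induction j, hij using Nat.le_induction with
    | base => exact fun _ h => h
    | succ j _ ih => exact fun hj h => hstep j hj (ih (by omega) h)
  have hrefl' : ∀ i : ℕ, i < g → F ((g - 1 - i : ℕ) : ℤ) = 1 - F i := by
    intro i hi
    rw [show ((g - 1 - i : ℕ) : ℤ) = -1 - (i : ℤ) + g by omega, hgper, hrefl]
  have hex1 : ∃ c : ℕ, F c = 1 := ⟨g - 1, by rw [Nat.cast_sub hgpos]; exact_mod_cast hg1⟩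
  set c := Nat.find hex1 with hc
  have hc1 : F c = 1 := Nat.find_spec hex1
  have hcmin : ∀ i < c, F (i : ℤ) = 0 := by
    intro i hi
    have h1 : F (i : ℤ) ≠ 1 := Nat.find_min hex1 hi
    have := hle i; have := hnonneg i; omega
  have hcg : c < g := by
    have : c ≤ g - 1 := Nat.find_min' hex1 (by rw [Nat.cast_sub hgpos]; exact_mod_cast hg1)
    omega
  have hc0 : 0 < c := by
    rcases Nat.eq_zero_or_pos c with h | h
    · rw [h] at hc1; simp [h0] at hc1
    · exact h
  have hg2 : g = 2 * c := by
    -- The reflection sends the first `1` at `c` to a `0` and the last `0` at `c - 1` to a `1`.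
    have h1 := hrefl' c hcg
    have h2 := hrefl' (c - 1) (by omega)
    rw [hcmin (c - 1) (by omega)] at h2
    rw [hc1] at h1
    have h3 : g - 1 - c < c := by
      by_contra! h
      have := hup c _ h (by omega) hc1
      omega
    have h4 : c ≤ g - 1 - (c - 1) := by
      by_contra! h
      have := hcmin _ h
      omega
    omega
  refine ⟨c, hc0, fun z => ?_⟩
  have hcz : (0 : ℤ) < c := by exact_mod_cast hc0
  have hgz : (0 : ℤ) < 2 * c := by linarith
  have hq := Int.mul_ediv_add_emod z (2 * c)
  have hs0 := Int.emod_nonneg z hgz.ne'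
  have hs1 := Int.emod_lt_of_pos z hgz
  set q := z / (2 * c : ℤ)
  obtain ⟨s, hs⟩ := Int.eq_ofNat_of_zero_le hs0
  rw [hs] at hq hs1
  have hFz : F z = F s := by
    rw [← hq, add_comm, show (2 * (c : ℤ)) = (g : ℤ) by rw [hg2]; push_cast; ring, mul_comm,
      ← smul_eq_mul, hgper.zsmul q s]
  have hsg : s < g := by rw [hg2]; exact_mod_cast hs1
  rw [hFz]
  by_cases hsc : s < c
  · rw [hcmin s hsc]
    have : z / (c : ℤ) = 2 * q := by
      rw [Int.ediv_eq_iff_of_pos hcz]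
      have : (s : ℤ) < c := by exact_mod_cast hsc
      constructor <;> nlinarith
    omega
  · push Not at hsc
    rw [hup c s hsc hsg hc1]
    have : z / (c : ℤ) = 2 * q + 1 := by
      rw [Int.ediv_eq_iff_of_pos hcz]
      have : (c : ℤ) ≤ s := by exact_mod_cast hsc
      constructor <;> nlinarith
    omega

/-! ### Recovering the parameters -/

/-- The indicator functions of the multiples of distinct positive integers are linearly
independent: a function on the positive integers is determined by its divisor sums. -/
lemma eq_of_sum_divisors_eq {a b : ℕ → ℕ}
    (h : ∀ z, 0 < z → ∑ d ∈ z.divisors, a d = ∑ d ∈ z.divisors, b d) :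
    ∀ z, 0 < z → a z = b z := by
  intro z
  induction z using Nat.strong_induction_on with
  | _ z ih =>
    intro hz
    have h1 := h z hz
    have h2 : ∑ d ∈ z.properDivisors, a d = ∑ d ∈ z.properDivisors, b d :=
      Finset.sum_congr rfl fun d hd =>
        ih d (Nat.mem_properDivisors.mp hd).2 (Nat.pos_of_mem_properDivisors hd)
    rw [← Nat.insert_self_properDivisors hz.ne', Finset.sum_insert Nat.self_notMem_properDivisors,
      Finset.sum_insert Nat.self_notMem_properDivisors] at h1
    omega

lemma sum_divisors_card_fiber {ι : Type*} [Fintype ι] (f : ι → ℕ) {z : ℕ} (hz : 0 < z) :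
    ∑ d ∈ z.divisors, (Finset.univ.filter fun i => f i = d).card =
      ∑ i, if f i ∣ z then 1 else 0 := by
  simp only [Finset.card_filter]
  rw [Finset.sum_comm]
  refine Finset.sum_congr rfl fun i _ => ?_
  rw [Finset.sum_ite_eq]
  simp [hz.ne']

end HookRatio

open HookRatio in
theorem theorem3 {K L : ℕ} (γ : Fin K → ℕ) (δ : Fin L → ℕ)
    (hγ : ∀ k, 0 < γ k) (hδ : ∀ l, 0 < δ l)
    (hne : ∀ k l, γ k ≠ δ l)
    (hint : ∀ μ : YoungDiagram, ∃ z : ℤ, HookRatio.hookRatio γ δ μ = z)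
    (hbal : ∑ k, (1 : ℚ) / (γ k : ℚ) = ∑ l, (1 : ℚ) / (δ l : ℚ))
    (hheight : (L : ℤ) - (K : ℤ) = 1) :
    K = 1 ∧ L = 2 ∧ ∀ (k : Fin K) (l : Fin L), δ l = 2 * γ k := by
  obtain ⟨N, hN, hper⟩ := exists_period_stepFun hγ hδ hbal
  have hshift : ∀ m t : ℤ, stepFun γ δ (m + t * N) = stepFun γ δ m := fun m t => by
    rw [← smul_eq_mul, hper.zsmul t m]
  have hnonneg : ∀ m, 0 ≤ stepFun γ δ m := by
    intro m
    obtain ⟨a, t, hat⟩ := exists_natCast_eq_add_mul hN m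
    rw [← hshift m t, ← hat]
    exact stepFun_natCast_nonneg hγ hδ hint a
  have hhook : ∀ m n, stepFun γ δ (m + n) ≤
      stepFun γ δ m + stepFun γ δ n + stepFun γ δ (m + n + 1) := by
    intro m n
    obtain ⟨a, t, hat⟩ := exists_natCast_eq_add_mul hN m
    obtain ⟨b, s, hbs⟩ := exists_natCast_eq_add_mul hN n
    rw [← hshift m t, ← hshift n s, ← hshift (m + n) (t + s), ← hshift (m + n + 1) (t + s),
      show m + n + (t + s) * N = (m + t * N) + (n + s * N) by ring,
      show m + n + 1 + (t + s) * N = (m + t * N) + (n + s * N) + 1 by ring, ← hat, ← hbs]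
    exact stepFun_hook_natCast hγ hδ hint a b
  obtain ⟨c, hc, hF⟩ := exists_square_wave hN hper (stepFun_zero γ δ) hnonneg
    (fun n => by rw [stepFun_neg_one_sub hγ hδ, hheight]) hhook
  have hdvd : ∀ z : ℕ, 0 < z →
      (∑ k, if γ k ∣ z then 1 else 0) + 2 * (if 2 * c ∣ z then 1 else 0) =
        (∑ l, if δ l ∣ z then 1 else 0) + if c ∣ z then 1 else 0 := by
    intro z _
    have h1 := stepFun_sub_stepFun_sub_one hγ hδ (z : ℤ)
    have h2 := ediv_sub_ediv_sub_one hc (z : ℤ)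
    have h3 := ediv_sub_ediv_sub_one (show 0 < 2 * c by omega) (z : ℤ)
    rw [hF, hF] at h1
    push_cast at h3
    have h4 : ((∑ k, if (γ k : ℤ) ∣ z then 1 else 0) + 2 * (if (2 * c : ℤ) ∣ z then 1 else 0) : ℤ) =
        (∑ l, if (δ l : ℤ) ∣ z then 1 else 0) + if (c : ℤ) ∣ z then 1 else 0 := by
      linarith
    exact_mod_cast h4
  have hcount : ∀ x, 0 < x →
      (Finset.univ.filter fun k => γ k = x).card + 2 * (if 2 * c = x then 1 else 0) =
        (Finset.univ.filter fun l => δ l = x).card + if c = x then 1 else 0 := by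
    apply eq_of_sum_divisors_eq
    intro z hz
    simp only [Finset.sum_add_distrib, ← Finset.mul_sum, sum_divisors_card_fiber _ hz,
      Finset.sum_ite_eq, Nat.mem_divisors, hz.ne', ne_eq, not_false_eq_true, and_true]
    exact hdvd z hz
  have hγc : ∀ k, γ k = c := by
    intro k
    have h := hcount (γ k) (hγ k)
    have h1 : 0 < (Finset.univ.filter fun i => γ i = γ k).card :=
      Finset.card_pos.mpr ⟨k, by simp⟩
    have h2 : (Finset.univ.filter fun l => δ l = γ k).card = 0 := by
      simpa using fun l => (hne k l).symm
    rw [h2] at h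
    by_contra hk
    rw [if_neg (Ne.symm hk)] at h
    omega
  have hδc : ∀ l, δ l = 2 * c := by
    intro l
    have h := hcount (δ l) (hδ l)
    have h1 : 0 < (Finset.univ.filter fun i => δ i = δ l).card :=
      Finset.card_pos.mpr ⟨l, by simp⟩
    have h2 : (Finset.univ.filter fun k => γ k = δ l).card = 0 := by
      simpa using fun k => hne k l
    rw [h2] at h
    by_contra hl
    rw [if_neg (Ne.symm hl)] at h
    omega
  have hKL : 2 * K = L := by
    have hc' : (c : ℚ) ≠ 0 := by exact_mod_cast hc.ne'
    simp only [hγc, hδc, Finset.sum_const, Finset.card_univ, Fintype.card_fin, nsmul_eq_mul] at hbal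
    push_cast at hbal
    field_simp at hbal
    have h : (2 * K : ℚ) = L := by linarith
    exact_mod_cast h
  refine ⟨by omega, by omega, fun k l => by rw [hδc, hγc]⟩
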